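/- Throughout, inner products are linear in the first argument, $A^\dagger$ is the adjoint, and $\ell^2=\ell^2(\{1,2,3,\dots\};\mathbb C)$. Let $N,M$ be natural numbers. *Data and teacher.* For $x\in\mathbb C^N$ and $k\ge 1$ put $p_k(x)=\frac1{\sqrt k}\sum_{n=1}^N x_n^k$, and $\langle h,p(x)\rangle=\sum_{k\ge1}h_k\overline{p_k(x)}$ for $h\in\ell^2$ for which the series converges. Let $V$ be the law of the eigenvalues of an $N\times N$ Haar unitary matrix, that is, the probability measure on $\{x\in\mathbb C^N:|x_n|=1\}$ with density $\frac1{N!}\prod_{i<j}|x_i-x_j|^2$ with respect to the uniform law. Let $f(z)=\sum_{1\le j\le\sqrt N}\frac{\alpha_j}{\sqrt{j!}}z^j$ with $\alpha_j\in\mathbb C$ not all zero, let $s=\min\{j\ge1:\alpha_j\ne0\}$ be its information exponent, let $h^*\in\ell^2$ have norm $1$ and satisfy $h^*_k=0$ for $k>\sqrt N$, and let $F(x)=f(\langle h^*,p(x)\rangle)$. *Student.* Let $\sigma(z)=\sum_{k\ge1}c_kz^k$ be an analytic activation whose power series converges absolutely on the closed unit disk, with $\sum_k k|c_k|^2<\infty$,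 and let $a_1,\dots,a_M$ be points of the unit circle. For $w\in\mathbb C^M$ let $F_w(x)=g(\langle w,\Phi(x)\rangle)$ with $\Phi_m(x)=\sum_{n=1}^N\sigma(a_mx_n)$ and $g(z)=\frac{\alpha_s}{|\alpha_s|\sqrt{s!}}z^s$. Let $A:\mathbb C^M\to\ell^2$ be the matrix $A_{km}=\overline{c_k\sqrt k\,a_m^k}$, so that $\langle w,\Phi(x)\rangle=\langle Aw,p(x)\rangle$ whenever $|x_n|=1$ for all $n$. Assume that $A^\dagger A$ is invertible. Let $$L(w)=\mathbb E_{x\sim V}\big[-\mathrm{Re}\,\big(F(x)\,\overline{F_w(x)}\big)\big]+\frac{|\alpha_s|}2\|Aw\|^{2s},\qquad \nabla=\nabla_{w_R}+i\nabla_{w_C}\quad (w=w_R+iw_C),$$ and $\delta=1-\|P_Ah^*\|^2$, where $P_A$ is the orthogonal projection onto the range of $A$. **Theorem.** The random variable in the expectation is integrable for every $w$, and $L$ is differentiable in $(w_R,w_C)$. Let $J\subseteq\mathbb R$ be a time interval and let $w:J\to\mathbb C^M$ solve the preconditioned gradient flow $$\dot w=-\frac1{s|\alpha_s|}(A^\dagger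 A)^{-1}\nabla L(w)\qquad\text{on }J .$$ Let $m=\langle Aw,h^*\rangle=re^{i\theta}$ with $r\ge0$ and $\theta$ real, and let $v=\|P_{h^*}^\perp Aw\|^2$, where $P_{h^*}^\perp$ is the orthogonal projection onto the orthogonal complement of $h^*$. Then the summary statistics obey the closed system $$\dot r=(1-\delta)r^{s-1}\cos s\theta-(v+r^2)^{s-1}r,$$ $$\frac{d}{dt}\cos s\theta=(1-\delta)\,s\,r^{s-2}\,(1-\cos^2s\theta),$$ $$\dot v=2\delta r^s\cos s\theta-2(v+r^2)^{s-1}v.$$ The third equation holds at every $t\in J$; the first holds at every $t\in J$ with $r(t)\neq0$, and also where $r(t)=0$ if $s\ge2$; the second holds at every $t\in J$ with $r(t)\ne0$. -/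

import Mathlib

open MeasureTheory
open scoped ComplexConjugate Nat

noncomputable section

namespace DeepSets

/-- The feature space: square-summable complex sequences indexed by `k = 1, 2, 3, …`. -/
abbrev FeatureSpace : Type := lp (fun _ : ℕ+ => ℂ) 2

/-- The parameter space `ℂ^M`. -/
abbrev ParamSpace (M : ℕ) : Type := EuclideanSpace ℂ (Fin M)

/-- The normalized power sum `p_k(x) = k^{-1/2} ∑ₙ xₙ^k`. -/
def powerSum {N : ℕ} (k : ℕ+) (x : Fin N → ℂ) : ℂ :=
  ((1 / √((k : ℕ) : ℝ) : ℝ) : ℂ) * ∑ n, x n ^ (k : ℕ)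

/-- The pairing `⟨h, p(x)⟩ = ∑ₖ hₖ conj (pₖ(x))`; as everywhere here, the inner product is linear
in its first argument. -/
def pairing {N : ℕ} (h : FeatureSpace) (x : Fin N → ℂ) : ℂ :=
  ∑' k : ℕ+, h k * conj (powerSum k x)

/-- The uniform probability law on the complex unit circle, as a measure on `ℂ`. -/
def uniformCircle : Measure ℂ :=
  (AddCircle.haarAddCircle (T := 1)).map fun t => ((AddCircle.toCircle t : Circle) : ℂ)

/-- The squared Vandermonde law on `N` copies of the unit circle, that is, the law of the
eigenvalues of a Haar distributed `N × N` unitary matrix. -/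
def vandermondeLaw (N : ℕ) : Measure (Fin N → ℂ) :=
  (Measure.pi fun _ : Fin N => uniformCircle).withDensity fun x =>
    ENNReal.ofReal ((N ! : ℝ)⁻¹ * ∏ i, ∏ j ∈ Finset.Ioi i, ‖x i - x j‖ ^ 2)

/-- The teacher link `f(z) = ∑_{1 ≤ j ≤ √N} α_j / √(j!) z^j`. -/
def teacherLink (N : ℕ) (α : ℕ → ℂ) (z : ℂ) : ℂ :=
  ∑ j ∈ Finset.Icc 1 (Nat.sqrt N), α j / ((√(j ! : ℝ) : ℝ) : ℂ) * z ^ j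

/-- The teacher `F(x) = f(⟨h*, p(x)⟩)`. -/
def teacher {N : ℕ} (α : ℕ → ℂ) (hstar : FeatureSpace) (x : Fin N → ℂ) : ℂ :=
  teacherLink N α (pairing hstar x)

/-- `s` is the information exponent of `∑ⱼ α_j / √(j!) z^j`: the least `j ≥ 1` with `α_j ≠ 0`. -/
def IsInformationExponent (α : ℕ → ℂ) (s : ℕ) : Prop :=
  IsLeast {j : ℕ | 1 ≤ j ∧ α j ≠ 0} s

/-- An analytic activation `σ(z) = ∑_{k ≥ 1} c_k z^k` without constant term. The series converges
on the closed unit disk (the network evaluates `σ` on the unit circle), and `∑ₖ k |c_k|² < ∞`, so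
that the columns of the matrix `A` below are square-summable. -/
structure Activation where
  toFun : ℂ → ℂ
  coeff : ℕ → ℂ
  coeff_zero : coeff 0 = 0
  hasSum : ∀ z : ℂ, ‖z‖ ≤ 1 → HasSum (fun k => coeff k * z ^ k) (toFun z)
  summable_sq : Summable fun k : ℕ => (k : ℝ) * ‖coeff k‖ ^ 2

/-- The symmetric embedding `Φ_m(x) = ∑ₙ σ(a_m xₙ)`. -/
def embedding {N M : ℕ} (σ : Activation) (a : Fin M → Circle) (x : Fin N → ℂ) (m : Fin M) : ℂ :=
  ∑ n, σ.toFun ((a m : ℂ) * x n)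

/-- The student link `g(z) = α_s / (|α_s| √(s!)) z^s`. -/
def studentLink (α : ℕ → ℂ) (s : ℕ) (z : ℂ) : ℂ :=
  α s / ((‖α s‖ * √(s ! : ℝ) : ℝ) : ℂ) * z ^ s

/-- The student `F_w(x) = g(⟨w, Φ(x)⟩)`. -/
def student {N M : ℕ} (σ : Activation) (a : Fin M → Circle) (α : ℕ → ℂ) (s : ℕ)
    (w : ParamSpace M) (x : Fin N → ℂ) : ℂ :=
  studentLink α s (∑ m, w m * conj (embedding σ a x m))

/-- One column of `A`. -/
def featureColumn (σ : Activation) (b : Circle) : FeatureSpace :=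
  ⟨fun k : ℕ+ => conj (σ.coeff k * ((√((k : ℕ) : ℝ) : ℝ) : ℂ) * (b : ℂ) ^ (k : ℕ)), by
    refine memℓp_gen ?_
    have h := σ.summable_sq.comp_injective PNat.coe_injective
    refine h.congr fun k => ?_
    simp [mul_pow, Real.sq_sqrt, mul_comm, Circle.norm_coe]⟩

/-- The `∞ × M` matrix `A`, as an operator `ℂ^M → ℓ²`. -/
def featureMatrix {M : ℕ} (σ : Activation) (a : Fin M → Circle) :
    ParamSpace M →L[ℂ] FeatureSpace :=
  ∑ m, (EuclideanSpace.proj m : ParamSpace M →L[ℂ] ℂ).smulRight (featureColumn σ (a m))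

theorem featureMatrix_apply {M : ℕ} (σ : Activation) (a : Fin M → Circle) (w : ParamSpace M)
    (k : ℕ+) : featureMatrix σ a w k =
      ∑ m, conj (σ.coeff k * ((√((k : ℕ) : ℝ) : ℝ) : ℂ) * (a m : ℂ) ^ (k : ℕ)) * w m := by
  simp only [featureMatrix, sum_apply, ContinuousLinearMap.smulRight_apply]
  rw [lp.coeFn_sum, Finset.sum_apply]
  refine Finset.sum_congr rfl fun m _ => ?_
  rw [lp.coeFn_smul, Pi.smul_apply, smul_eq_mul, mul_comm]
  rfl

/-- `⟨w, Φ(x)⟩ = ⟨Aw, p(x)⟩` on the torus, so that `F_w(x) = g(⟨Aw, p(x)⟩)`. -/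
theorem sum_mul_conj_embedding {N M : ℕ} (σ : Activation) (a : Fin M → Circle)
    (w : ParamSpace M) (x : Fin N → ℂ) (hx : ∀ n, ‖x n‖ = 1) :
    ∑ m, w m * conj (embedding σ a x m) = pairing (featureMatrix σ a w) x := by
  have key : ∀ m n, HasSum (fun k : ℕ+ => σ.coeff k * ((a m : ℂ) * x n) ^ (k : ℕ))
      (σ.toFun ((a m : ℂ) * x n)) := by
    intro m n
    have h := σ.hasSum ((a m : ℂ) * x n) (by simp [hx n, Circle.norm_coe])
    refine (PNat.coe_injective.hasSum_iff ?_).2 h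
    intro k hk
    have : k = 0 := by
      by_contra h0
      exact hk ⟨⟨k, Nat.pos_of_ne_zero h0⟩, rfl⟩
    simp [this, σ.coeff_zero]
  have h2 : HasSum (fun k : ℕ+ => ∑ m, w m * conj (∑ n, σ.coeff k * ((a m : ℂ) * x n) ^ (k : ℕ)))
      (∑ m, w m * conj (embedding σ a x m)) := by
    refine hasSum_sum fun m _ => HasSum.mul_left _ ?_
    exact Complex.hasSum_conj'.2 (by
      simpa [embedding] using hasSum_sum fun n (_ : n ∈ Finset.univ) => key m n)
  rw [← h2.tsum_eq, pairing]
  refine tsum_congr fun k => ?_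
  rw [featureMatrix_apply, Finset.sum_mul]
  refine Finset.sum_congr rfl fun m _ => ?_
  have hk : ((√((k : ℕ) : ℝ) : ℝ) : ℂ) ≠ 0 := by
    have : (0 : ℝ) < ((k : ℕ) : ℝ) := by exact_mod_cast k.pos
    exact_mod_cast (Real.sqrt_pos.2 this).ne'
  simp only [powerSum, map_mul, map_sum, map_pow, Complex.conj_ofReal, mul_pow, ← Finset.mul_sum]
  push_cast
  field_simp

/-- The correlational loss
`L(w) = 𝔼_{x ∼ V}[-Re (F(x) conj (F_w(x)))] + |α_s| / 2 * ‖Aw‖^(2s)`. -/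
def loss (N : ℕ) {M : ℕ} (σ : Activation) (a : Fin M → Circle) (α : ℕ → ℂ) (s : ℕ)
    (hstar : FeatureSpace) (w : ParamSpace M) : ℝ :=
  (∫ x, -(teacher α hstar x * conj (student σ a α s w x)).re ∂(vandermondeLaw N)) +
    ‖α s‖ / 2 * ‖featureMatrix σ a w‖ ^ (2 * s)

/-- The gradient `∇ = ∇_{w_R} + i ∇_{w_C}` of a real function of `w = w_R + i w_C`. -/
def complexGradient {M : ℕ} (L : ParamSpace M → ℝ) (w : ParamSpace M) : ParamSpace M :=
  WithLp.toLp 2 fun m =>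
    ((fderiv ℝ L w (EuclideanSpace.single m (1 : ℂ)) : ℝ) : ℂ) +
      Complex.I * ((fderiv ℝ L w (EuclideanSpace.single m Complex.I) : ℝ) : ℂ)

/-- `A† A` as an operator on `ℂ^M`. -/
def gram {M : ℕ} (A : ParamSpace M →L[ℂ] FeatureSpace) : ParamSpace M →L[ℂ] ParamSpace M :=
  (ContinuousLinearMap.adjoint A).comp A

/-- The vector field `-(s |α_s|)⁻¹ (A† A)⁻¹ ∇L(w)` of the preconditioned gradient flow. -/
def flowField (N : ℕ) {M : ℕ} (σ : Activation) (a : Fin M → Circle) (α : ℕ → ℂ) (s : ℕ)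
    (hstar : FeatureSpace) (w : ParamSpace M) : ParamSpace M :=
  (-(1 / ((s : ℝ) * ‖α s‖))) •
    Ring.inverse (gram (featureMatrix σ a)) (complexGradient (loss N σ a α s hstar) w)

/-- `m = ⟨Aw, h*⟩`, linear in `w` (Mathlib's `inner` is linear in its second argument). -/
def correlation {M : ℕ} (A : ParamSpace M →L[ℂ] FeatureSpace) (hstar : FeatureSpace)
    (w : ParamSpace M) : ℂ :=
  inner ℂ hstar (A w)

/-- `v = ‖P_{h*}^⊥ A w‖²`. -/
def orthogonalMass {M : ℕ} (A : ParamSpace M →L[ℂ] FeatureSpace) (hstar : FeatureSpace)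
    (w : ParamSpace M) : ℝ :=
  ‖(Submodule.span ℂ {hstar})ᗮ.starProjection (A w)‖ ^ 2

/-- `δ = 1 - ‖P_A h*‖²`, with `P_A` the orthogonal projection onto the range of `A`. -/
def approxError {M : ℕ} (A : ParamSpace M →L[ℂ] FeatureSpace) (hstar : FeatureSpace) : ℝ :=
  1 - ‖A.range.starProjection hstar‖ ^ 2

end DeepSets

end

/-! The theorem reduces to the closed form `L(w) = |α_s| (‖Aw‖^(2s) / 2 - Re m^s)` (`loss_eq`); the
rest is calculus in finitely many variables.

The closed form follows from Gaussian moments: if `h` lives in degrees at most `K` and `j * K ≤ N`,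
then `⟨h, p⟩^j` and `⟨u, p⟩^s` pair under `V` to `s! ⟨h, u⟩^s` when `j = s` and to `0` otherwise.
Only one side needs low degree. Since `j` and the degrees of `h*` are at most `√N`, the bound holds
for every term of the teacher, and only `j = s` survives.

The moments come from a Fock space argument. The density of `V` is `|Δ|² / N!`, so the pairing is a
torus inner product of polynomials multiplied by the Vandermonde `Δ`, and monomials are orthonormal
there. Multiplication by the `j`-th power sum acts as a creation operator; the adjoint for the
`k`-th one is `lower k`. Each `lower k` with `k ≥ 1` kills `Δ`, and `[lower k, psum j] = k δ_{kj}`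
on alternating polynomials of low degree (`lower_psum_mul`). Wick's induction is
`torusInner_powerPoly_pow`.

For the flow, `A (A†A)⁻¹ A†` is the projection `P_A`, so `m' = (1 - δ) conj(m)^(s-1) - ‖Aw‖^(2(s-1))
m` with `‖Aw‖² = v + r²`. The three equations are this one in polar form, together with the
derivative of `‖Aw‖²`. -/

noncomputable section

namespace DeepSets

/-! ### Alternating polynomials and the commutation relation for power sums. -/

section Alternating

open MvPolynomial

variable {N : ℕ}

/-- A polynomial is alternating if it changes sign under every transposition of variables. -/
def IsAlternating (F : MvPolynomial (Fin N) ℂ) : Prop :=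
  ∀ i j, i ≠ j → rename (Equiv.swap i j) F = -F

theorem IsAlternating.coeff_mapDomain_swap {F : MvPolynomial (Fin N) ℂ} (hF : IsAlternating F)
    {i j : Fin N} (hij : i ≠ j) (e : Fin N →₀ ℕ) :
    coeff (e.mapDomain (Equiv.swap i j)) F = -coeff e F := by
  have h := coeff_rename_mapDomain (Equiv.swap i j) (Equiv.injective _) F e
  rw [hF i j hij, coeff_neg] at h
  rw [← h, neg_neg]

theorem IsAlternating.coeff_eq_zero {F : MvPolynomial (Fin N) ℂ} (hF : IsAlternating F)
    {e : Fin N →₀ ℕ} {i j : Fin N} (hij : i ≠ j) (he : e i = e j) : coeff e F = 0 := by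
  have h := hF.coeff_mapDomain_swap hij e
  have h2 : e.mapDomain (Equiv.swap i j) = e := by
    ext m
    rw [Finsupp.mapDomain_equiv_apply, Equiv.symm_swap, Equiv.swap_apply_def]
    split_ifs with h1 h2
    · rw [h1, he]
    · rw [h2, he]
    · rfl
  rw [h2] at h
  exact self_eq_neg.1 h

theorem IsAlternating.symm_mul {S F : MvPolynomial (Fin N) ℂ} (hS : S.IsSymmetric)
    (hF : IsAlternating F) : IsAlternating (S * F) := by
  intro i j hij
  rw [map_mul, hS, hF i j hij, mul_neg]

/-- For `n` outside `{a, b}` the shifted exponent still repeats, so its coefficient vanishes. The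
terms at `a` and `b` are exchanged by the transposition and cancel; `p` sees only `e n`, hence
treats both alike. -/
theorem IsAlternating.sum_coeff_shift_eq_zero {F : MvPolynomial (Fin N) ℂ} (hF : IsAlternating F)
    {e : Fin N →₀ ℕ} {a b : Fin N} (hne : a ≠ b) (hab : e a = e b) (k j : ℕ) (p : ℕ → Prop)
    [DecidablePred p] :
    ∑ n, (if p (e n) then coeff (Finsupp.single n k + e - Finsupp.single n j) F else 0) = 0 := by
  rw [← Finset.sum_subset (Finset.subset_univ {a, b}), Finset.sum_pair hne, ← hab]
  · split_ifs with h
    · rw [add_eq_zero_iff_eq_neg, ← hF.coeff_mapDomain_swap hne]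
      congr 1
      ext m
      rw [Finsupp.mapDomain_equiv_apply, Equiv.symm_swap]
      by_cases hma : m = a
      · subst hma
        simp [hab]
      by_cases hmb : m = b
      · subst hmb
        simp [hab, hne, Ne.symm hne]
      rw [Equiv.swap_apply_of_ne_of_ne hma hmb]
      simp [Finsupp.single_eq_of_ne hma, Finsupp.single_eq_of_ne hmb]
    · simp
  · intro n _ hn
    simp only [Finset.mem_insert, Finset.mem_singleton, not_or] at hn
    split_ifs
    · refine hF.coeff_eq_zero hne ?_
      simp [Finsupp.single_eq_of_ne (Ne.symm hn.1), Finsupp.single_eq_of_ne (Ne.symm hn.2), hab]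
    · rfl

theorem sum_range_card_le_sum (S : Finset ℕ) : ∑ i ∈ Finset.range S.card, i ≤ ∑ i ∈ S, i := by
  have h := Finset.sum_range_le_sum (s := S.map Nat.castEmbedding) (c := 0) (by simp)
  simp only [Finset.card_map, zero_add, Finset.sum_map, Nat.castEmbedding_apply] at h
  rw [← Nat.cast_sum, ← Nat.cast_sum] at h
  exact Nat.cast_le.1 h

theorem choose_two_le_sum_of_injective {e : Fin N → ℕ} (he : Function.Injective e) :
    N.choose 2 ≤ ∑ n, e n := by
  have h := sum_range_card_le_sum (Finset.univ.image e)
  rw [Finset.card_image_of_injective _ he, Finset.sum_image he.injOn, Finset.card_univ,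
    Fintype.card_fin, Finset.sum_range_id, ← Nat.choose_two_right] at h
  exact h

/-- Adjoining `v` gives `N + 1` distinct naturals, with sum at least `0 + ⋯ + N`. Hence skipping a
small value forces a large degree, which is the source of every low-degree hypothesis below. -/
theorem choose_two_add_le_sum_of_injective {e : Fin N → ℕ} (he : Function.Injective e) {v : ℕ}
    (hv : ∀ n, e n ≠ v) : N.choose 2 + N ≤ ∑ n, e n + v := by
  have hmem : v ∉ Finset.univ.image e := by simpa using hv
  have h := sum_range_card_le_sum (insert v (Finset.univ.image e))
  rw [Finset.card_insert_of_notMem hmem, Finset.card_image_of_injective _ he,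
    Finset.sum_insert hmem, Finset.sum_image he.injOn, Finset.card_univ,
    Fintype.card_fin, Finset.sum_range_succ, Finset.sum_range_id, ← Nat.choose_two_right] at h
  omega

/-- The adjoint of multiplication by the power sum of degree `k`, with respect to the inner product
for which the monomials are orthonormal. -/
def lower (k : ℕ) (F : MvPolynomial (Fin N) ℂ) : MvPolynomial (Fin N) ℂ :=
  ∑ n, F.divMonomial (Finsupp.single n k)

theorem coeff_lower (k : ℕ) (F : MvPolynomial (Fin N) ℂ) (e : Fin N →₀ ℕ) :
    coeff e (lower k F) = ∑ n, coeff (Finsupp.single n k + e) F := by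
  simp [lower, coeff_sum]

theorem lower_sum {ι : Type*} (k : ℕ) (S : Finset ι) (F : ι → MvPolynomial (Fin N) ℂ) :
    lower k (∑ i ∈ S, F i) = ∑ i ∈ S, lower k (F i) := by
  ext e
  simp only [coeff_lower, coeff_sum]
  exact Finset.sum_comm

theorem lower_C_mul (k : ℕ) (c : ℂ) (F : MvPolynomial (Fin N) ℂ) :
    lower k (C c * F) = C c * lower k F := by
  ext e
  simp [coeff_lower, Finset.mul_sum]

theorem coeff_X_pow_mul_eq (m : Fin N) (j : ℕ) (F : MvPolynomial (Fin N) ℂ) (e : Fin N →₀ ℕ) :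
    coeff e (X m ^ j * F) = if j ≤ e m then coeff (e - Finsupp.single m j) F else 0 := by
  rw [X_pow_eq_monomial, coeff_monomial_mul']
  simp [Finsupp.single_le_iff]

/-- The two operations act on different variables unless `n = m`. In that case multiplying first
keeps monomials whose final exponent is below `j`, which dividing first loses; the extra term is
this boundary defect. -/
theorem coeff_divMonomial_X_pow_mul (n m : Fin N) (k j : ℕ) (F : MvPolynomial (Fin N) ℂ)
    (e : Fin N →₀ ℕ) :
    coeff e ((X m ^ j * F).divMonomial (Finsupp.single n k)) =
      coeff e (X m ^ j * F.divMonomial (Finsupp.single n k)) +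
        if n = m ∧ e n < j ∧ j ≤ k + e n then
          coeff (Finsupp.single n k + e - Finsupp.single n j) F else 0 := by
  rw [coeff_divMonomial, coeff_X_pow_mul_eq, coeff_X_pow_mul_eq, coeff_divMonomial]
  have hsub : j ≤ e m →
      Finsupp.single n k + e - Finsupp.single m j = Finsupp.single n k + (e - Finsupp.single m j) :=
    fun h => add_tsub_assoc_of_le (Finsupp.single_le_iff.2 h) _
  by_cases hnm : n = m
  · subst hnm
    simp only [Finsupp.add_apply, Finsupp.single_eq_same, true_and]
    by_cases h1 : j ≤ e n
    · rw [if_pos (by omega), if_pos h1, if_neg (by omega), hsub h1, add_zero]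
    · by_cases h2 : j ≤ k + e n
      · rw [if_pos h2, if_neg h1, if_pos ⟨by omega, h2⟩, zero_add]
      · rw [if_neg h2, if_neg h1, if_neg (by omega), zero_add]
  · have : (Finsupp.single n k + e) m = e m := by
      simp [Finsupp.single_eq_of_ne (Ne.symm hnm)]
    rw [this]
    by_cases h1 : j ≤ e m
    · simp [h1, hnm, hsub h1]
    · simp [h1, hnm]

theorem coeff_lower_psum_mul (k j : ℕ) (F : MvPolynomial (Fin N) ℂ) (e : Fin N →₀ ℕ) :
    coeff e (lower k (psum (Fin N) ℂ j * F)) = coeff e (psum (Fin N) ℂ j * lower k F) +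
      ∑ n, if e n < j ∧ j ≤ k + e n then
        coeff (Finsupp.single n k + e - Finsupp.single n j) F else 0 := by
  have h1 : lower k (psum (Fin N) ℂ j * F) =
      ∑ n, ∑ m, (X m ^ j * F).divMonomial (Finsupp.single n k) := by
    rw [psum, Finset.sum_mul, lower_sum]
    exact Finset.sum_comm
  have h2 : psum (Fin N) ℂ j * lower k F =
      ∑ n, ∑ m, X m ^ j * F.divMonomial (Finsupp.single n k) := by
    simp only [psum, lower, Finset.sum_mul, Finset.mul_sum]
  rw [h1, h2]
  simp only [coeff_sum, ← Finset.sum_add_distrib, coeff_divMonomial_X_pow_mul]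
  refine Finset.sum_congr rfl fun n _ => ?_
  rw [Finset.sum_add_distrib]
  congr 1
  simp only [ite_and, Finset.sum_ite_eq, Finset.mem_univ, if_true]

theorem sum_le_totalDegree {F : MvPolynomial (Fin N) ℂ} {e : Fin N →₀ ℕ} (h : coeff e F ≠ 0) :
    ∑ n, e n ≤ F.totalDegree := by
  have := le_totalDegree (mem_support_iff.2 h)
  rwa [Finsupp.sum_fintype _ _ (by simp)] at this

theorem IsAlternating.injective_of_coeff_ne_zero {F : MvPolynomial (Fin N) ℂ}
    (hF : IsAlternating F) {e : Fin N →₀ ℕ} (h : coeff e F ≠ 0) : Function.Injective e := by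
  intro i j hij
  by_contra hne
  exact h (hF.coeff_eq_zero hne hij)

theorem card_filter_lt_of_injective {e : Fin N → ℕ} (he : Function.Injective e) {j d : ℕ}
    (hd : ∑ n, e n ≤ N.choose 2 + d) (hj : d + j ≤ N) :
    (Finset.univ.filter fun n => e n < j).card = j := by
  have hsurj : ∀ v < j, ∃ n, e n = v := by
    intro v hv
    by_contra! h
    have := choose_two_add_le_sum_of_injective he h
    omega
  have : (Finset.univ.filter fun n => e n < j).image e = Finset.range j := by
    ext v
    simp only [Finset.mem_image, Finset.mem_filter, Finset.mem_univ, true_and, Finset.mem_range]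
    constructor
    · rintro ⟨n, hn, rfl⟩
      exact hn
    · intro hv
      obtain ⟨n, rfl⟩ := hsurj v hv
      exact ⟨n, hv, rfl⟩
  rw [← Finset.card_image_of_injective _ he, this, Finset.card_range]

/-- On alternating polynomials of low degree, `lower k` and multiplication by `psum j` satisfy the
canonical commutation relation. -/
theorem lower_psum_mul {F : MvPolynomial (Fin N) ℂ} (hF : IsAlternating F) {d j : ℕ}
    (hd : F.totalDegree ≤ N.choose 2 + d) (hj : d + j ≤ N) (k : ℕ) :
    lower k (psum (Fin N) ℂ j * F) =
      psum (Fin N) ℂ j * lower k F + C (if k = j then (k : ℂ) else 0) * F := by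
  ext e
  rw [coeff_lower_psum_mul, coeff_add, coeff_C_mul]
  congr 1
  by_cases hkj : k = j
  · subst hkj
    -- For `k = j` each defect is `coeff e F`, one for every exponent below `k`; in low degree there
    -- are exactly `k` of these.
    simp only [if_true, add_tsub_cancel_left, Nat.le_add_right, and_true]
    rw [← Finset.sum_filter, Finset.sum_const, nsmul_eq_mul]
    by_cases h0 : coeff e F = 0
    · simp [h0]
    rw [card_filter_lt_of_injective (hF.injective_of_coeff_ne_zero h0)
      ((sum_le_totalDegree h0).trans hd) hj]
  rw [if_neg hkj, zero_mul]
  by_cases hinj : Function.Injective e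
  · refine Finset.sum_eq_zero fun n _ => ?_
    split_ifs with hn
    · by_contra h0
      set e' := Finsupp.single n k + e - Finsupp.single n j with he'
      have hen : e' n = k + e n - j := by simp [he']
      have hem : ∀ m, m ≠ n → e' m = e m := fun m hm => by
        simp [he', Finsupp.single_eq_of_ne hm]
      -- For `k ≠ j` the shift moves the exponent at `n` off `e n < j`, and injectivity of `e` lets
      -- no other variable take that value. The gap contradicts the degree bound.
      have hmiss : ∀ m, e' m ≠ e n := by
        intro m
        by_cases hm : m = n
        · subst hm
          rw [hen]
          omega
        · rw [hem m hm]
          exact fun h => hm (hinj h)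
      have := choose_two_add_le_sum_of_injective (hF.injective_of_coeff_ne_zero h0) hmiss
      have := (sum_le_totalDegree h0).trans hd
      omega
    · rfl
  · obtain ⟨a, b, hab, hne⟩ : ∃ a b, e a = e b ∧ a ≠ b := by
      simpa [Function.Injective] using hinj
    exact hF.sum_coeff_shift_eq_zero hne hab k j fun x => x < j ∧ j ≤ k + x

theorem totalDegree_psum_le (k : ℕ) : (psum (Fin N) ℂ k).totalDegree ≤ k :=
  totalDegree_finsetSum_le fun _ _ => (totalDegree_X_pow _ _).le

/-- The linear combination of power sums with coefficients `c`. -/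
def powerPoly (N : ℕ) (S : Finset ℕ+) (c : ℕ+ → ℂ) : MvPolynomial (Fin N) ℂ :=
  ∑ k ∈ S, C (c k) * psum (Fin N) ℂ k

theorem powerPoly_isSymmetric (S : Finset ℕ+) (c : ℕ+ → ℂ) :
    (powerPoly N S c).IsSymmetric := by
  intro e
  simp [powerPoly, rename_psum]

theorem totalDegree_powerPoly_le {S : Finset ℕ+} (c : ℕ+ → ℂ) {K : ℕ}
    (hK : ∀ k ∈ S, (k : ℕ) ≤ K) : (powerPoly N S c).totalDegree ≤ K := by
  refine totalDegree_finsetSum_le fun k hk => (totalDegree_mul _ _).trans ?_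
  rw [totalDegree_C, zero_add]
  exact (totalDegree_psum_le _).trans (hK k hk)

theorem lower_powerPoly_mul {F : MvPolynomial (Fin N) ℂ} (hF : IsAlternating F) {d K : ℕ}
    (hd : F.totalDegree ≤ N.choose 2 + d) (hdK : d + K ≤ N) {S : Finset ℕ+} {c : ℕ+ → ℂ}
    (hK : ∀ k ∈ S, (k : ℕ) ≤ K) (hc : ∀ k ∉ S, c k = 0) (k : ℕ+) :
    lower k (powerPoly N S c * F) =
      powerPoly N S c * lower k F + C ((k : ℕ) * c k) * F := by
  have h : ∀ j ∈ S, lower k (C (c j) * psum (Fin N) ℂ j * F) =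
      C (c j) * psum (Fin N) ℂ j * lower k F + if k = j then C ((k : ℕ) * c k) * F else 0 := by
    intro j hj
    rw [mul_assoc, lower_C_mul, lower_psum_mul hF hd (by have := hK j hj; omega), mul_add,
      ← mul_assoc, ← mul_assoc, ← C_mul]
    congr 1
    by_cases hkj : k = j
    · subst hkj
      simp [mul_comm]
    · have : (k : ℕ) ≠ j := fun h => hkj (PNat.eq h)
      simp [hkj, this]
  rw [powerPoly, Finset.sum_mul, lower_sum, Finset.sum_congr rfl h, Finset.sum_add_distrib,
    Finset.sum_mul, Finset.sum_ite_eq]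
  split_ifs with hk
  · rfl
  · simp [hc k hk]

/-- The Vandermonde polynomial. -/
def vandermondePoly (N : ℕ) : MvPolynomial (Fin N) ℂ :=
  (Matrix.vandermonde (X : Fin N → MvPolynomial (Fin N) ℂ)).det

theorem isAlternating_vandermondePoly : IsAlternating (vandermondePoly N) := by
  intro i j hij
  have h := Matrix.det_permute (Equiv.swap i j)
    (Matrix.vandermonde (X : Fin N → MvPolynomial (Fin N) ℂ))
  rw [Equiv.Perm.sign_swap hij] at h
  rw [vandermondePoly, AlgHom.map_det]
  have h2 : (rename (Equiv.swap i j)).mapMatrix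
      (Matrix.vandermonde (X : Fin N → MvPolynomial (Fin N) ℂ)) =
      (Matrix.vandermonde (X : Fin N → MvPolynomial (Fin N) ℂ)).submatrix (Equiv.swap i j) id := by
    ext a b
    simp [Matrix.vandermonde_apply]
  rw [h2, h]
  simp

/-- The exponent vector of the term of the Vandermonde determinant attached to a permutation. -/
def permExponent (p : Equiv.Perm (Fin N)) : Fin N →₀ ℕ :=
  Finsupp.equivFunOnFinite.symm fun n => ((p n : Fin N) : ℕ)

theorem permExponent_injective : Function.Injective (permExponent (N := N)) := by
  intro p q h
  ext n
  exact DFunLike.congr_fun h n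

theorem vandermondePoly_eq_sum : vandermondePoly N =
    ∑ p : Equiv.Perm (Fin N), monomial (permExponent p) (((Equiv.Perm.sign p : ℤˣ) : ℤ) : ℂ) := by
  rw [vandermondePoly, ← Matrix.det_transpose, Matrix.det_apply]
  refine Finset.sum_congr rfl fun p _ => ?_
  rw [monomial_eq, Finsupp.prod_fintype _ _ (by simp), Units.smul_def, zsmul_eq_mul]
  simp [Matrix.vandermonde_apply, permExponent]

theorem totalDegree_vandermondePoly_le : (vandermondePoly N).totalDegree ≤ N.choose 2 := by
  rw [vandermondePoly_eq_sum]
  refine totalDegree_finsetSum_le fun p _ => (totalDegree_monomial_le _ _).trans ?_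
  rw [Finsupp.sum_fintype _ _ (by simp)]
  have : ∑ n, id (permExponent p n) = ∑ n : Fin N, (n : ℕ) := Equiv.sum_comp p fun n => (n : ℕ)
  rw [this, Fin.sum_univ_eq_sum_range (fun n => n), Finset.sum_range_id, Nat.choose_two_right]

/-- `Δ` is the vacuum: it has the least degree possible for an alternating polynomial, so raising
one entry of an injective exponent by `k > 0` overshoots it. Exponents with a repetition cancel in
pairs. -/
theorem lower_vandermondePoly (k : ℕ+) : lower k (vandermondePoly N) = 0 := by
  ext e
  rw [coeff_lower, coeff_zero]
  by_cases hinj : Function.Injective e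
  · refine Finset.sum_eq_zero fun n _ => ?_
    by_contra h0
    have hdeg := (sum_le_totalDegree h0).trans totalDegree_vandermondePoly_le
    have hk := k.pos
    have he := choose_two_le_sum_of_injective hinj
    simp only [Finsupp.add_apply, Finset.sum_add_distrib, Finsupp.single_apply, Finset.sum_ite_eq,
      Finset.mem_univ, if_true] at hdeg
    omega
  · obtain ⟨a, b, hab, hne⟩ : ∃ a b, e a = e b ∧ a ≠ b := by
      simpa [Function.Injective] using hinj
    simpa using isAlternating_vandermondePoly.sum_coeff_shift_eq_zero hne hab k 0 fun _ => True

/-- `lower k` acts as a derivation on powers of `powerPoly`, in low degree. -/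
theorem lower_powerPoly_pow_mul_vandermondePoly {K m : ℕ} (hmK : m * K ≤ N) {S : Finset ℕ+}
    {c : ℕ+ → ℂ} (hK : ∀ k ∈ S, (k : ℕ) ≤ K) (hc : ∀ k ∉ S, c k = 0) (k : ℕ+) :
    lower k (powerPoly N S c ^ m * vandermondePoly N) =
      C (m * ((k : ℕ) * c k)) * (powerPoly N S c ^ (m - 1) * vandermondePoly N) := by
  induction m with
  | zero => simp [lower_vandermondePoly]
  | succ m ih =>
    have hm : m * K + K ≤ N := by rwa [← Nat.succ_mul]
    have halt : IsAlternating (powerPoly N S c ^ m * vandermondePoly N) :=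
      isAlternating_vandermondePoly.symm_mul (by
        intro e
        rw [map_pow, powerPoly_isSymmetric S c e])
    have hdeg : (powerPoly N S c ^ m * vandermondePoly N).totalDegree ≤ N.choose 2 + m * K := by
      refine (totalDegree_mul _ _).trans ?_
      rw [add_comm]
      refine add_le_add totalDegree_vandermondePoly_le ((totalDegree_pow _ _).trans ?_)
      exact Nat.mul_le_mul_left _ (totalDegree_powerPoly_le c hK)
    rw [pow_succ', mul_assoc, lower_powerPoly_mul halt hdeg hm hK hc, ih (by omega),
      Nat.add_sub_cancel]
    -- At `m = 0` the truncated exponent `m - 1` is harmless, since its term carries the factor `m`.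
    rcases m with _ | m
    · simp
    · rw [Nat.add_sub_cancel, pow_succ']
      push_cast
      simp only [C_add, C_mul, map_one]
      ring

end Alternating

/-! ### Torus inner product, adjointness and Wick's formula. -/

section Torus

open MvPolynomial

variable {N : ℕ}

theorem measurable_toCircle :
    Measurable fun t : AddCircle (1 : ℝ) => ((AddCircle.toCircle t : Circle) : ℂ) :=
  (continuous_subtype_val.comp AddCircle.continuous_toCircle).measurable

instance isProbabilityMeasure_uniformCircle : IsProbabilityMeasure uniformCircle :=
  Measure.isProbabilityMeasure_map measurable_toCircle.aemeasurable

theorem ae_uniformCircle_norm_eq_one : ∀ᵐ z ∂uniformCircle, ‖z‖ = 1 := by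
  rw [uniformCircle, ae_map_iff measurable_toCircle.aemeasurable
    (isClosed_eq continuous_norm continuous_const).measurableSet]
  exact Filter.Eventually.of_forall fun t => Circle.norm_coe _

theorem integral_pow_mul_conj_pow_uniformCircle (a b : ℕ) :
    ∫ z, z ^ a * conj (z ^ b) ∂uniformCircle = if a = b then 1 else 0 := by
  rw [uniformCircle, integral_map measurable_toCircle.aemeasurable (by fun_prop)]
  have h := orthonormal_iff_ite.1 (orthonormal_fourier (T := 1)) b a
  rw [ContinuousMap.inner_toLp] at h
  have hpow : ∀ (n : ℕ) (t : AddCircle (1 : ℝ)),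
      ((AddCircle.toCircle t : Circle) : ℂ) ^ n = fourier (n : ℤ) t := by
    intro n t
    rw [fourier_apply, natCast_zsmul, AddCircle.toCircle_nsmul, Circle.coe_pow]
  simp only [hpow]
  rw [h]
  simp [eq_comm]

/-- The uniform law on `N` copies of the unit circle. -/
abbrev torusLaw (N : ℕ) : Measure (Fin N → ℂ) := Measure.pi fun _ : Fin N => uniformCircle

theorem ae_torusLaw_norm_eq_one : ∀ᵐ x ∂torusLaw N, ∀ n, ‖x n‖ = 1 := by
  rw [ae_all_iff]
  intro n
  exact (measurePreserving_eval (fun _ : Fin N => uniformCircle) n).quasiMeasurePreserving.ae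
    ae_uniformCircle_norm_eq_one

theorem integrable_torusLaw_of_continuous {f : (Fin N → ℂ) → ℂ} (hf : Continuous f) :
    Integrable f (torusLaw N) := by
  obtain ⟨C, hC⟩ := (isCompact_closedBall (0 : Fin N → ℂ) 1).exists_bound_of_continuousOn
    hf.continuousOn
  refine Integrable.of_bound hf.aestronglyMeasurable C ?_
  filter_upwards [ae_torusLaw_norm_eq_one] with x hx
  refine hC x ?_
  rw [mem_closedBall_zero_iff, pi_norm_le_iff_of_nonneg zero_le_one]
  exact fun n => (hx n).le

/-- The `L²` inner product of two polynomials over the torus. -/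
def torusInner (F G : MvPolynomial (Fin N) ℂ) : ℂ :=
  ∫ x, eval x F * conj (eval x G) ∂torusLaw N

theorem continuous_eval_mul_conj_eval (F G : MvPolynomial (Fin N) ℂ) :
    Continuous fun x : Fin N → ℂ => eval x F * conj (eval x G) :=
  (continuous_eval F).mul (Complex.continuous_conj.comp (continuous_eval G))

theorem torusInner_conj_symm (F G : MvPolynomial (Fin N) ℂ) :
    conj (torusInner F G) = torusInner G F := by
  rw [torusInner, ← integral_conj, torusInner]
  simp [mul_comm]

theorem torusInner_add_left (F F' G : MvPolynomial (Fin N) ℂ) :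
    torusInner (F + F') G = torusInner F G + torusInner F' G := by
  rw [torusInner, torusInner, torusInner, ← integral_add
    (integrable_torusLaw_of_continuous (continuous_eval_mul_conj_eval _ _))
    (integrable_torusLaw_of_continuous (continuous_eval_mul_conj_eval _ _))]
  simp [add_mul]

theorem torusInner_C_mul_left (c : ℂ) (F G : MvPolynomial (Fin N) ℂ) :
    torusInner (C c * F) G = c * torusInner F G := by
  rw [torusInner, torusInner, ← integral_const_mul]
  simp [mul_assoc]

theorem torusInner_zero_left (G : MvPolynomial (Fin N) ℂ) : torusInner 0 G = 0 := by
  simp [torusInner]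

theorem torusInner_sum_left {ι : Type*} (S : Finset ι) (F : ι → MvPolynomial (Fin N) ℂ)
    (G : MvPolynomial (Fin N) ℂ) :
    torusInner (∑ i ∈ S, F i) G = ∑ i ∈ S, torusInner (F i) G := by
  classical
  induction S using Finset.induction_on with
  | empty => simp [torusInner_zero_left]
  | insert i S hi ih => rw [Finset.sum_insert hi, Finset.sum_insert hi, torusInner_add_left, ih]

theorem torusInner_add_right (F G G' : MvPolynomial (Fin N) ℂ) :
    torusInner F (G + G') = torusInner F G + torusInner F G' := by
  rw [← torusInner_conj_symm, torusInner_add_left, map_add, torusInner_conj_symm,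
    torusInner_conj_symm]

theorem torusInner_zero_right (F : MvPolynomial (Fin N) ℂ) : torusInner F 0 = 0 := by
  simp [torusInner]

theorem torusInner_C_mul_right (c : ℂ) (F G : MvPolynomial (Fin N) ℂ) :
    torusInner F (C c * G) = conj c * torusInner F G := by
  rw [← torusInner_conj_symm, torusInner_C_mul_left, map_mul, torusInner_conj_symm]

theorem torusInner_monomial_monomial (e e' : Fin N →₀ ℕ) (c c' : ℂ) :
    torusInner (monomial e c) (monomial e' c') = if e = e' then c * conj c' else 0 := by
  have h : ∀ x : Fin N → ℂ, eval x (monomial e c) * conj (eval x (monomial e' c')) =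
      c * conj c' * ∏ n, (x n ^ e n * conj (x n ^ e' n)) := by
    intro x
    rw [eval_monomial, eval_monomial, Finsupp.prod_fintype _ _ (by simp),
      Finsupp.prod_fintype _ _ (by simp), Finset.prod_mul_distrib, map_mul, map_prod]
    ring
  rw [torusInner]
  simp only [h]
  rw [integral_const_mul, integral_fintype_prod_eq_prod (𝕜 := ℂ)
    (fun n (z : ℂ) => z ^ e n * conj (z ^ e' n))]
  simp only [integral_pow_mul_conj_pow_uniformCircle]
  rw [Finset.prod_ite_zero]
  simp [Finsupp.ext_iff]

theorem torusInner_monomial_left (e : Fin N →₀ ℕ) (c : ℂ) (G : MvPolynomial (Fin N) ℂ) :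
    torusInner (monomial e c) G = c * conj (coeff e G) := by
  induction G using MvPolynomial.induction_on' with
  | monomial e' c' =>
    rw [torusInner_monomial_monomial, coeff_monomial]
    by_cases h : e = e'
    · simp [h]
    · simp [h, Ne.symm h]
  | add G G' hG hG' => rw [torusInner_add_right, hG, hG', coeff_add, map_add, mul_add]

/-- On a monomial both sides collect the coefficients of `G` at the exponents raised by `k` in one
variable. No degree restriction enters. -/
theorem torusInner_psum_mul_left (k : ℕ) (F G : MvPolynomial (Fin N) ℂ) :
    torusInner (psum (Fin N) ℂ k * F) G = torusInner F (lower k G) := by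
  induction F using MvPolynomial.induction_on' with
  | monomial e c =>
    have h : psum (Fin N) ℂ k * monomial e c = ∑ n, monomial (Finsupp.single n k + e) c := by
      simp [psum, Finset.sum_mul, X_pow_eq_monomial, monomial_mul]
    rw [h, torusInner_sum_left, torusInner_monomial_left, coeff_lower, map_sum, Finset.mul_sum]
    simp only [torusInner_monomial_left]
  | add F F' hF hF' => rw [mul_add, torusInner_add_left, torusInner_add_left, hF, hF']

theorem torusInner_vandermondePoly_self :
    torusInner (vandermondePoly N) (vandermondePoly N) = (N ! : ℂ) := by
  have hcoeff : ∀ p : Equiv.Perm (Fin N), coeff (permExponent p) (vandermondePoly N) =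
      (((Equiv.Perm.sign p : ℤˣ) : ℤ) : ℂ) := by
    intro p
    rw [vandermondePoly_eq_sum, coeff_sum, Finset.sum_eq_single p]
    · simp
    · intro q _ hq
      rw [coeff_monomial, if_neg fun h => hq (permExponent_injective h)]
    · simp
  have h : torusInner (vandermondePoly N) (vandermondePoly N) =
      ∑ p : Equiv.Perm (Fin N), (1 : ℂ) := by
    conv_lhs => arg 1; rw [vandermondePoly_eq_sum]
    rw [torusInner_sum_left]
    refine Finset.sum_congr rfl fun p _ => ?_
    rw [torusInner_monomial_left, hcoeff]
    rcases Int.units_eq_one_or (Equiv.Perm.sign p) with hp | hp <;> simp [hp]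
  rw [h]
  simp [Fintype.card_perm]

/-- Induction on `s`: one factor from the left crosses over as a combination of `lower k`, which
differentiates the power on the right. Commutators are taken only on the right, so `s` and the
degrees in `S'` are unrestricted. -/
theorem torusInner_powerPoly_pow {K m : ℕ} (hmK : m * K ≤ N) {S : Finset ℕ+}
    {c : ℕ+ → ℂ} (hK : ∀ k ∈ S, (k : ℕ) ≤ K) (hc : ∀ k ∉ S, c k = 0) (S' : Finset ℕ+)
    (c' : ℕ+ → ℂ) (s : ℕ) :
    torusInner (powerPoly N S' c' ^ s * vandermondePoly N)
        (powerPoly N S c ^ m * vandermondePoly N) =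
      if m = s then (N ! : ℂ) * s ! * (∑ k ∈ S', c' k * ((k : ℕ) * conj (c k))) ^ s else 0 := by
  induction s generalizing m with
  | zero =>
    rcases m with _ | m
    · simp [torusInner_vandermondePoly_self]
    · rw [if_neg (Nat.succ_ne_zero m), pow_zero, one_mul, ← torusInner_conj_symm, pow_succ',
        mul_assoc]
      conv_lhs => rw [powerPoly, Finset.sum_mul, torusInner_sum_left]
      rw [Finset.sum_eq_zero, map_zero]
      intro k _
      rw [mul_assoc, torusInner_C_mul_left, torusInner_psum_mul_left, lower_vandermondePoly,
        torusInner_zero_right, mul_zero]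
  | succ s ih =>
    have h : torusInner (powerPoly N S' c' ^ (s + 1) * vandermondePoly N)
        (powerPoly N S c ^ m * vandermondePoly N) =
        ∑ k ∈ S', c' k * (m * ((k : ℕ) * conj (c k)) *
          torusInner (powerPoly N S' c' ^ s * vandermondePoly N)
            (powerPoly N S c ^ (m - 1) * vandermondePoly N)) := by
      rw [pow_succ', mul_assoc]
      conv_lhs => arg 1; arg 1; rw [powerPoly]
      rw [Finset.sum_mul, torusInner_sum_left]
      refine Finset.sum_congr rfl fun k _ => ?_
      rw [mul_assoc, torusInner_C_mul_left, torusInner_psum_mul_left,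
        lower_powerPoly_pow_mul_vandermondePoly hmK hK hc, torusInner_C_mul_right]
      simp
    rw [h]
    rcases m with _ | m
    · simp
    · rw [Nat.add_sub_cancel, ih (le_trans (Nat.mul_le_mul_right _ (Nat.le_succ m)) hmK)]
      by_cases hms : m = s
      · subst hms
        rw [if_pos rfl, if_pos rfl, pow_succ' _ m, mul_left_comm, Finset.sum_mul,
          Nat.factorial_succ]
        refine Finset.sum_congr rfl fun k _ => ?_
        push_cast
        ring
      · simp [hms]

end Torus

/-! ### Gaussian moments under the eigenvalue law. -/

section Moments

open MvPolynomial

variable {N : ℕ}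

theorem norm_eval_vandermondePoly_sq (x : Fin N → ℂ) :
    ∏ i, ∏ j ∈ Finset.Ioi i, ‖x i - x j‖ ^ 2 = ‖eval x (vandermondePoly N)‖ ^ 2 := by
  have h : eval x (vandermondePoly N) = ∏ i, ∏ j ∈ Finset.Ioi i, (x j - x i) := by
    rw [vandermondePoly, Matrix.det_vandermonde]
    simp
  rw [h]
  simp only [norm_prod, ← Finset.prod_pow, norm_sub_rev]

theorem continuous_vandermonde_density :
    Continuous fun x : Fin N → ℂ =>
      (N ! : ℝ)⁻¹ * ∏ i, ∏ j ∈ Finset.Ioi i, ‖x i - x j‖ ^ 2 := by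
  fun_prop

theorem integral_vandermondeLaw (f : (Fin N → ℂ) → ℂ) :
    ∫ x, f x ∂vandermondeLaw N = (N ! : ℂ)⁻¹ *
      ∫ x, eval x (vandermondePoly N) * conj (eval x (vandermondePoly N)) * f x ∂torusLaw N := by
  rw [vandermondeLaw, integral_withDensity_eq_integral_toReal_smul
    continuous_vandermonde_density.measurable.ennreal_ofReal
    (Filter.Eventually.of_forall fun _ => ENNReal.ofReal_lt_top), ← integral_const_mul]
  refine integral_congr_ae (Filter.Eventually.of_forall fun x => ?_)
  simp only
  rw [ENNReal.toReal_ofReal (by positivity), norm_eval_vandermondePoly_sq, Complex.real_smul,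
    Complex.mul_conj, Complex.normSq_eq_norm_sq]
  push_cast
  ring

theorem integral_eval_mul_conj_eval_vandermondeLaw (F G : MvPolynomial (Fin N) ℂ) :
    ∫ x, eval x F * conj (eval x G) ∂vandermondeLaw N =
      (N ! : ℂ)⁻¹ * torusInner (F * vandermondePoly N) (G * vandermondePoly N) := by
  rw [integral_vandermondeLaw, torusInner]
  congr 1
  refine integral_congr_ae (Filter.Eventually.of_forall fun x => ?_)
  simp only [map_mul]
  ring

theorem integrable_vandermonde_density :
    Integrable (fun x : Fin N → ℂ => (N ! : ℝ)⁻¹ * ∏ i, ∏ j ∈ Finset.Ioi i, ‖x i - x j‖ ^ 2)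
      (torusLaw N) := by
  have h := integrable_torusLaw_of_continuous
    (Complex.continuous_ofReal.comp (continuous_vandermonde_density (N := N)))
  exact h.re

instance isFiniteMeasure_vandermondeLaw : IsFiniteMeasure (vandermondeLaw N) :=
  isFiniteMeasure_withDensity_ofReal integrable_vandermonde_density.2

theorem ae_vandermondeLaw_norm_eq_one : ∀ᵐ x ∂vandermondeLaw N, ∀ n, ‖x n‖ = 1 :=
  (withDensity_absolutelyContinuous _ _).ae_le ae_torusLaw_norm_eq_one

theorem sum_mul_conj_powerSum_eq (S : Finset ℕ+) (h : FeatureSpace) (x : Fin N → ℂ) :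
    ∑ k ∈ S, h k * conj (powerSum k x) = conj (eval x
      (powerPoly N S fun k => conj (h k) * ((1 / √((k : ℕ) : ℝ) : ℝ) : ℂ))) := by
  simp only [powerPoly, psum, powerSum, map_sum, map_mul, eval_C, map_pow, eval_X,
    Complex.conj_conj, Complex.conj_ofReal, mul_assoc]

theorem continuous_sum_mul_conj_powerSum (S : Finset ℕ+) (h : FeatureSpace) :
    Continuous fun x : Fin N → ℂ => ∑ k ∈ S, h k * conj (powerSum k x) := by
  simp only [sum_mul_conj_powerSum_eq]
  exact Complex.continuous_conj.comp (continuous_eval _)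

/-- The two normalisations `k^(-1/2)` absorb the commutator constant `k`, turning the weighted sum
into the plain `ℓ²` inner product. -/
theorem ofReal_one_div_sqrt_mul (k : ℕ+) :
    ((1 / √((k : ℕ) : ℝ) : ℝ) : ℂ) * ((k : ℕ) * ((1 / √((k : ℕ) : ℝ) : ℝ) : ℂ)) = 1 := by
  have hk : (0 : ℝ) < ((k : ℕ) : ℝ) := by exact_mod_cast k.pos
  have h : 1 / √((k : ℕ) : ℝ) * (((k : ℕ) : ℝ) * (1 / √((k : ℕ) : ℝ))) = 1 := by
    have h2 := Real.mul_self_sqrt hk.le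
    have h3 := (Real.sqrt_pos.2 hk).ne'
    field_simp
    rw [sq, h2]
  exact_mod_cast congrArg (Complex.ofReal) h

/-- The joint moments of finite pairings: power sums of low degree have Gaussian moments. -/
theorem integral_sum_pow_mul_conj_sum_pow {K j : ℕ} (hjK : j * K ≤ N) {S : Finset ℕ+}
    {h : FeatureSpace} (hK : ∀ k ∈ S, (k : ℕ) ≤ K) (hS : ∀ k ∉ S, h k = 0) (S' : Finset ℕ+)
    (u : FeatureSpace) (s : ℕ) :
    ∫ x, (∑ k ∈ S, h k * conj (powerSum k x)) ^ j *
        conj ((∑ k ∈ S', u k * conj (powerSum k x)) ^ s) ∂vandermondeLaw N =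
      if j = s then (s ! : ℂ) * (∑ k ∈ S', inner ℂ (u k) (h k)) ^ s else 0 := by
  have hmain := integral_eval_mul_conj_eval_vandermondeLaw
    (powerPoly N S' (fun k => conj (u k) * ((1 / √((k : ℕ) : ℝ) : ℝ) : ℂ)) ^ s)
    (powerPoly N S (fun k => conj (h k) * ((1 / √((k : ℕ) : ℝ) : ℝ) : ℂ)) ^ j)
  rw [torusInner_powerPoly_pow hjK hK (fun k hk => by simp [hS k hk])] at hmain
  have hN : (N ! : ℂ) ≠ 0 := by exact_mod_cast N.factorial_ne_zero
  calc _ = _ := integral_congr_ae (Filter.Eventually.of_forall fun x => by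
        simp only [sum_mul_conj_powerSum_eq, map_pow, Complex.conj_conj]
        rw [mul_comm])
    _ = _ := hmain
    _ = _ := by
      split_ifs
      · rw [mul_assoc, inv_mul_cancel_left₀ hN]
        congr 2
        refine Finset.sum_congr rfl fun k _ => ?_
        rw [map_mul, Complex.conj_conj, Complex.conj_ofReal, RCLike.inner_apply]
        linear_combination conj (u k) * h k * ofReal_one_div_sqrt_mul k
      · simp

theorem norm_powerSum_le (k : ℕ+) {x : Fin N → ℂ} (hx : ∀ n, ‖x n‖ = 1) :
    ‖powerSum k x‖ ≤ N / √((k : ℕ) : ℝ) := by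
  rw [powerSum, norm_mul, Complex.norm_real, Real.norm_of_nonneg (by positivity), one_div,
    ← div_eq_inv_mul]
  gcongr
  refine (norm_sum_le _ _).trans ?_
  simp [hx]

theorem norm_mul_conj_powerSum_le (u : FeatureSpace) (k : ℕ+) {x : Fin N → ℂ}
    (hx : ∀ n, ‖x n‖ = 1) :
    ‖u k * conj (powerSum k x)‖ ≤ N * (‖u k‖ / √((k : ℕ) : ℝ)) := by
  rw [norm_mul, RCLike.norm_conj]
  calc _ ≤ ‖u k‖ * (N / √((k : ℕ) : ℝ)) := by gcongr; exact norm_powerSum_le k hx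
    _ = _ := by ring

/-- On the torus `|p_k| ≤ N / √k`, so this weighted summability gives convergence with a uniform
bound, later used for domination. Membership in `ℓ²` alone would not give it. -/
theorem hasSum_pairing {u : FeatureSpace} (hu : Summable fun k : ℕ+ => ‖u k‖ / √((k : ℕ) : ℝ))
    {x : Fin N → ℂ} (hx : ∀ n, ‖x n‖ = 1) :
    HasSum (fun k : ℕ+ => u k * conj (powerSum k x)) (pairing u x) :=
  (Summable.of_norm_bounded (hu.mul_left (N : ℝ))
    fun k => norm_mul_conj_powerSum_le u k hx).hasSum

theorem norm_sum_mul_conj_powerSum_le {u : FeatureSpace}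
    (hu : Summable fun k : ℕ+ => ‖u k‖ / √((k : ℕ) : ℝ)) (S : Finset ℕ+) {x : Fin N → ℂ}
    (hx : ∀ n, ‖x n‖ = 1) :
    ‖∑ k ∈ S, u k * conj (powerSum k x)‖ ≤ N * ∑' k : ℕ+, ‖u k‖ / √((k : ℕ) : ℝ) := by
  refine (norm_sum_le_of_le S fun k _ => norm_mul_conj_powerSum_le u k hx).trans ?_
  rw [← Finset.mul_sum]
  gcongr
  exact hu.sum_le_tsum _ fun _ _ => by positivity

theorem norm_pairing_le {u : FeatureSpace}
    (hu : Summable fun k : ℕ+ => ‖u k‖ / √((k : ℕ) : ℝ)) {x : Fin N → ℂ}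
    (hx : ∀ n, ‖x n‖ = 1) :
    ‖pairing u x‖ ≤ N * ∑' k : ℕ+, ‖u k‖ / √((k : ℕ) : ℝ) :=
  le_of_tendsto (hasSum_pairing hu hx).norm
    (Filter.Eventually.of_forall fun S => norm_sum_mul_conj_powerSum_le hu S hx)

theorem aestronglyMeasurable_pairing {u : FeatureSpace}
    (hu : Summable fun k : ℕ+ => ‖u k‖ / √((k : ℕ) : ℝ)) :
    AEStronglyMeasurable (fun x : Fin N → ℂ => pairing u x) (vandermondeLaw N) := by
  refine aestronglyMeasurable_of_tendsto_ae Filter.atTop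
    (fun S : Finset ℕ+ => (continuous_sum_mul_conj_powerSum S u).aestronglyMeasurable) ?_
  filter_upwards [ae_vandermondeLaw_norm_eq_one] with x hx
  exact hasSum_pairing hu hx

theorem integrable_pairing_pow_mul_conj_pairing_pow {h u : FeatureSpace}
    (hh : Summable fun k : ℕ+ => ‖h k‖ / √((k : ℕ) : ℝ))
    (hu : Summable fun k : ℕ+ => ‖u k‖ / √((k : ℕ) : ℝ)) (j s : ℕ) :
    Integrable (fun x : Fin N → ℂ => pairing h x ^ j * conj (pairing u x ^ s))
      (vandermondeLaw N) := by
  refine Integrable.of_bound (((aestronglyMeasurable_pairing hh).pow j).mul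
    (Complex.continuous_conj.comp_aestronglyMeasurable ((aestronglyMeasurable_pairing hu).pow s)))
    ((N * ∑' k : ℕ+, ‖h k‖ / √((k : ℕ) : ℝ)) ^ j *
      (N * ∑' k : ℕ+, ‖u k‖ / √((k : ℕ) : ℝ)) ^ s) ?_
  filter_upwards [ae_vandermondeLaw_norm_eq_one] with x hx
  rw [norm_mul, RCLike.norm_conj, norm_pow, norm_pow]
  gcongr
  · exact norm_pairing_le hh hx
  · exact norm_pairing_le hu hx

theorem finite_coe_le (K : ℕ) : {k : ℕ+ | (k : ℕ) ≤ K}.Finite :=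
  (Set.finite_Iic K).preimage PNat.coe_injective.injOn

theorem summable_norm_div_sqrt_of_eventually_zero {h : FeatureSpace} {K : ℕ}
    (hK : ∀ k : ℕ+, K < (k : ℕ) → h k = 0) :
    Summable fun k : ℕ+ => ‖h k‖ / √((k : ℕ) : ℝ) := by
  refine summable_of_ne_finset_zero (s := (finite_coe_le K).toFinset) fun k hk => ?_
  rw [hK k (by simpa using hk), norm_zero, zero_div]

/-- The joint moments of two pairings against the power sums of the eigenvalues of a Haar unitary
matrix, when one of the two has low degree. -/
theorem integral_pairing_pow_mul_conj_pairing_pow {K j : ℕ} (hjK : j * K ≤ N)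
    {h u : FeatureSpace} (hK : ∀ k : ℕ+, K < (k : ℕ) → h k = 0)
    (hu : Summable fun k : ℕ+ => ‖u k‖ / √((k : ℕ) : ℝ)) (s : ℕ) :
    ∫ x, pairing h x ^ j * conj (pairing u x ^ s) ∂vandermondeLaw N =
      if j = s then (s ! : ℂ) * (inner ℂ u h) ^ s else 0 := by
  have hh := summable_norm_div_sqrt_of_eventually_zero hK
  have hS : ∀ k ∉ (finite_coe_le K).toFinset, h k = 0 := fun k hk => hK k (by simpa using hk)
  have hpair : ∀ x : Fin N → ℂ,
      pairing h x = ∑ k ∈ (finite_coe_le K).toFinset, h k * conj (powerSum k x) := fun x =>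
    tsum_eq_sum fun k hk => by rw [hS k hk, zero_mul]
  -- Only `u` has to be truncated: the pairing with `h` is already a finite sum.
  have hlim : Filter.Tendsto (fun S' : Finset ℕ+ => ∫ x, pairing h x ^ j *
      conj ((∑ k ∈ S', u k * conj (powerSum k x)) ^ s) ∂vandermondeLaw N) Filter.atTop
      (nhds (∫ x, pairing h x ^ j * conj (pairing u x ^ s) ∂vandermondeLaw N)) := by
    refine tendsto_integral_filter_of_dominated_convergence
      (fun _ => (N * ∑' k : ℕ+, ‖h k‖ / √((k : ℕ) : ℝ)) ^ j *
        (N * ∑' k : ℕ+, ‖u k‖ / √((k : ℕ) : ℝ)) ^ s)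
      (Filter.Eventually.of_forall fun S' => ((aestronglyMeasurable_pairing hh).pow j).mul
        (Complex.continuous_conj.comp
          ((continuous_sum_mul_conj_powerSum S' u).pow s)).aestronglyMeasurable)
      (Filter.Eventually.of_forall fun S' => ?_) (integrable_const _) ?_
    · filter_upwards [ae_vandermondeLaw_norm_eq_one] with x hx
      rw [norm_mul, RCLike.norm_conj, norm_pow, norm_pow]
      gcongr
      · exact norm_pairing_le hh hx
      · exact norm_sum_mul_conj_powerSum_le hu S' hx
    · filter_upwards [ae_vandermondeLaw_norm_eq_one] with x hx
      exact ((Complex.continuous_conj.tendsto _).comp ((hasSum_pairing hu hx).pow s)).const_mul _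
  refine tendsto_nhds_unique hlim ?_
  simp only [hpair]
  simp only [integral_sum_pow_mul_conj_sum_pow hjK (fun k hk => by simpa using hk) hS]
  split_ifs
  · exact ((lp.hasSum_inner u h).pow s).const_mul _
  · exact tendsto_const_nhds

theorem Activation.summable_norm_coeff (σ : Activation) : Summable fun k => ‖σ.coeff k‖ := by
  have h := (σ.hasSum 1 (by simp)).summable
  simpa using h.norm

/-- The `√k` in `A` cancels the denominator, leaving `|c_k|`, summable because the series of `σ`
converges absolutely at `1`. -/
theorem summable_norm_featureMatrix_div_sqrt {M : ℕ} (σ : Activation) (a : Fin M → Circle)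
    (w : ParamSpace M) :
    Summable fun k : ℕ+ => ‖featureMatrix σ a w k‖ / √((k : ℕ) : ℝ) := by
  have hc : Summable fun k : ℕ+ => ‖σ.coeff k‖ * ∑ m, ‖w m‖ :=
    (σ.summable_norm_coeff.comp_injective PNat.coe_injective).mul_right _
  refine Summable.of_nonneg_of_le (fun _ => by positivity) (fun k => ?_) hc
  have hk : (0 : ℝ) < √((k : ℕ) : ℝ) := Real.sqrt_pos.2 (by exact_mod_cast k.pos)
  rw [div_le_iff₀ hk, featureMatrix_apply, Finset.mul_sum, Finset.sum_mul]
  refine norm_sum_le_of_le _ fun m _ => le_of_eq ?_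
  simp only [norm_mul, RCLike.norm_conj, norm_pow, Circle.norm_coe, one_pow, mul_one,
    Complex.norm_real, Real.norm_of_nonneg hk.le]
  ring

/-! ### Closed form of the loss. -/

section Loss

variable {M : ℕ} (σ : Activation) (a : Fin M → Circle) {α : ℕ → ℂ} {s : ℕ} {hstar : FeatureSpace}

theorem ae_teacher_mul_conj_student (w : ParamSpace M) :
    (fun x => teacher α hstar x * conj (student σ a α s w x)) =ᵐ[vandermondeLaw N]
      fun x => ∑ j ∈ Finset.Icc 1 (Nat.sqrt N), α j / ((√(j ! : ℝ) : ℝ) : ℂ) *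
        conj (α s / ((‖α s‖ * √(s ! : ℝ) : ℝ) : ℂ)) *
          (pairing hstar x ^ j * conj (pairing (featureMatrix σ a w) x ^ s)) := by
  filter_upwards [ae_vandermondeLaw_norm_eq_one] with x hx
  rw [student, sum_mul_conj_embedding σ a w x hx, studentLink, teacher, teacherLink,
    Finset.sum_mul]
  refine Finset.sum_congr rfl fun j _ => ?_
  rw [map_mul]
  ring

theorem integrable_teacher_mul_conj_student
    (hsupp : ∀ k : ℕ+, Nat.sqrt N < (k : ℕ) → hstar k = 0) (w : ParamSpace M) :
    Integrable (fun x => teacher α hstar x * conj (student σ a α s w x)) (vandermondeLaw N) :=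
  (integrable_finsetSum _ fun _ _ => (integrable_pairing_pow_mul_conj_pairing_pow
    (summable_norm_div_sqrt_of_eventually_zero hsupp)
    (summable_norm_featureMatrix_div_sqrt σ a w) _ _).const_mul _).congr
    (ae_teacher_mul_conj_student σ a w).symm

theorem integral_teacher_mul_conj_student (hs1 : 1 ≤ s) (hsN : s ≤ Nat.sqrt N) (hαs : α s ≠ 0)
    (hsupp : ∀ k : ℕ+, Nat.sqrt N < (k : ℕ) → hstar k = 0) (w : ParamSpace M) :
    ∫ x, teacher α hstar x * conj (student σ a α s w x) ∂vandermondeLaw N =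
      ‖α s‖ * inner ℂ (featureMatrix σ a w) hstar ^ s := by
  rw [integral_congr_ae (ae_teacher_mul_conj_student σ a w), integral_finsetSum _ fun _ _ =>
    (integrable_pairing_pow_mul_conj_pairing_pow
      (summable_norm_div_sqrt_of_eventually_zero hsupp)
      (summable_norm_featureMatrix_div_sqrt σ a w) _ _).const_mul _]
  have hterm : ∀ j ∈ Finset.Icc 1 (Nat.sqrt N),
      ∫ x, α j / ((√(j ! : ℝ) : ℝ) : ℂ) * conj (α s / ((‖α s‖ * √(s ! : ℝ) : ℝ) : ℂ)) *
          (pairing hstar x ^ j * conj (pairing (featureMatrix σ a w) x ^ s)) ∂vandermondeLaw N =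
        if j = s then ‖α s‖ * inner ℂ (featureMatrix σ a w) hstar ^ s else 0 := by
    intro j hj
    rw [integral_const_mul, integral_pairing_pow_mul_conj_pairing_pow
      -- The degree budget: `j * √N ≤ √N * √N ≤ N`, with integer square roots.
      ((Nat.mul_le_mul_right _ (Finset.mem_Icc.1 hj).2).trans (Nat.sqrt_le N)) hsupp
      (summable_norm_featureMatrix_div_sqrt σ a w)]
    split_ifs with hjs
    · subst hjs
      have h1 : ((√(j ! : ℝ) : ℝ) : ℂ) * ((√(j ! : ℝ) : ℝ) : ℂ) = (j ! : ℂ) := by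
        rw [← Complex.ofReal_mul, Real.mul_self_sqrt (by positivity), Complex.ofReal_natCast]
      have h2 : (j ! : ℂ) ≠ 0 := by exact_mod_cast j.factorial_ne_zero
      have h3 : ((√(j ! : ℝ) : ℝ) : ℂ) ≠ 0 := fun h => h2 (by rw [← h1, h, zero_mul])
      have h4 : (‖α j‖ : ℂ) ≠ 0 := by simpa using hαs
      have h5 := Complex.mul_conj' (α j)
      rw [map_div₀, Complex.conj_ofReal, ← h1]
      push_cast
      field_simp
      rw [h5]
    · rw [mul_zero]
  rw [Finset.sum_congr rfl hterm, Finset.sum_ite_eq' , if_pos (Finset.mem_Icc.2 ⟨hs1, hsN⟩)]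

theorem loss_eq (hs1 : 1 ≤ s) (hsN : s ≤ Nat.sqrt N) (hαs : α s ≠ 0)
    (hsupp : ∀ k : ℕ+, Nat.sqrt N < (k : ℕ) → hstar k = 0) (w : ParamSpace M) :
    loss N σ a α s hstar w =
      ‖α s‖ * (‖featureMatrix σ a w‖ ^ (2 * s) / 2 -
        (correlation (featureMatrix σ a) hstar w ^ s).re) := by
  have h1 : ∫ x, -(teacher α hstar x * conj (student σ a α s w x)).re ∂vandermondeLaw N =
      -(∫ x, teacher α hstar x * conj (student σ a α s w x) ∂vandermondeLaw N).re := by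
    rw [integral_neg]
    congr 1
    exact integral_re (integrable_teacher_mul_conj_student σ a hsupp w)
  rw [loss, h1, integral_teacher_mul_conj_student σ a hs1 hsN hαs hsupp, Complex.re_ofReal_mul,
    correlation, ← inner_conj_symm hstar, ← map_pow, Complex.conj_re]
  ring

end Loss

end Moments

/-! ### Gradient of the loss and the preconditioned field. -/

section Gradient

variable {M : ℕ}

/-- `∇_{w_R} + i ∇_{w_C}` is the Riesz representative for the real inner product `Re ⟨·, ·⟩`:
testing on `e_m` and `i e_m` reads off the real and imaginary parts of `G m`. -/
theorem complexGradient_eq_of_hasFDerivAt {L : ParamSpace M → ℝ} {L' : ParamSpace M →L[ℝ] ℝ}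
    {w G : ParamSpace M} (hL : HasFDerivAt L L' w) (hG : ∀ u, L' u = (inner ℂ G u).re) :
    complexGradient L w = G := by
  ext m
  simp only [complexGradient, hL.fderiv, hG, EuclideanSpace.inner_single_right]
  apply Complex.ext <;> simp

theorem hasFDerivAt_norm_sq_comp (A : ParamSpace M →L[ℂ] FeatureSpace) (w : ParamSpace M) :
    ∃ D : ParamSpace M →L[ℝ] ℝ, HasFDerivAt (fun w => ‖A w‖ ^ 2) D w ∧
      ∀ u, D u = 2 * (inner ℂ (A w) (A u)).re := by
  have hA : HasFDerivAt (fun w => A w) (A.restrictScalars ℝ) w :=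
    (A.restrictScalars ℝ).hasFDerivAt
  have h := Complex.reCLM.hasFDerivAt.comp w (hA.inner ℂ hA)
  refine ⟨_, h.congr_of_eventuallyEq (Filter.Eventually.of_forall fun w => ?_), fun u => ?_⟩
  · simp [inner_self_eq_norm_sq_to_K, ← Complex.ofReal_pow]
  · simp only [ContinuousLinearMap.comp_apply, ContinuousLinearMap.prod_apply, fderivInnerCLM_apply,
      ContinuousLinearMap.coe_restrictScalars', Complex.reCLM_apply, Complex.add_re]
    rw [← inner_conj_symm (A u), Complex.conj_re]
    ring

theorem hasFDerivAt_correlation (A : ParamSpace M →L[ℂ] FeatureSpace) (hstar : FeatureSpace)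
    (w : ParamSpace M) :
    HasFDerivAt (correlation A hstar) (((innerSL ℂ hstar).comp A).restrictScalars ℝ) w :=
  (((innerSL ℂ hstar).comp A).restrictScalars ℝ).hasFDerivAt

theorem hasFDerivAt_loss_formula (A : ParamSpace M →L[ℂ] FeatureSpace) (hstar : FeatureSpace)
    (c : ℝ) (s : ℕ) (w : ParamSpace M) :
    ∃ D : ParamSpace M →L[ℝ] ℝ,
      HasFDerivAt (fun w => c * (‖A w‖ ^ (2 * s) / 2 - (correlation A hstar w ^ s).re)) D w ∧
      ∀ u, D u = (inner ℂ ((c * s : ℝ) • (((‖A w‖ ^ 2) ^ (s - 1) : ℝ) • gram A w -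
        conj (correlation A hstar w) ^ (s - 1) • ContinuousLinearMap.adjoint A hstar)) u).re := by
  obtain ⟨D, hD, hDu⟩ := hasFDerivAt_norm_sq_comp A w
  have h1 := (hasDerivAt_pow s (‖A w‖ ^ 2)).comp_hasFDerivAt w hD
  have h2 := Complex.reCLM.hasFDerivAt.comp w ((hasFDerivAt_correlation A hstar w).pow s)
  refine ⟨_, (((h1.const_mul (1 / 2)).sub h2).const_mul c).congr_of_eventuallyEq
    (Filter.Eventually.of_forall fun w => ?_), fun u => ?_⟩
  · simp only [Pi.sub_apply, Function.comp_apply, Complex.reCLM_apply]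
    rw [pow_mul]
    ring
  · have e1 : inner ℂ ((c * s : ℝ) • (((‖A w‖ ^ 2) ^ (s - 1) : ℝ) • gram A w -
        conj (correlation A hstar w) ^ (s - 1) • ContinuousLinearMap.adjoint A hstar)) u =
        ((c * s : ℝ) : ℂ) * ((((‖A w‖ ^ 2) ^ (s - 1) : ℝ) : ℂ) * inner ℂ (A w) (A u) -
          correlation A hstar w ^ (s - 1) * inner ℂ hstar (A u)) := by
      rw [← Complex.coe_smul, ← Complex.coe_smul, inner_smul_left, inner_sub_left, inner_smul_left,
        inner_smul_left, ContinuousLinearMap.adjoint_inner_left, gram,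
        ContinuousLinearMap.comp_apply, ContinuousLinearMap.adjoint_inner_left]
      simp
    rw [e1, Complex.re_ofReal_mul, Complex.sub_re, Complex.re_ofReal_mul]
    simp [hDu, mul_assoc, nsmul_eq_mul]
    left
    ring

theorem gram_inverse_apply {A : ParamSpace M →L[ℂ] FeatureSpace} (hA : IsUnit (gram A))
    (w : ParamSpace M) : Ring.inverse (gram A) (gram A w) = w := by
  have h := Ring.inverse_mul_cancel _ hA
  exact DFunLike.congr_fun h w

theorem apply_gram_inverse {A : ParamSpace M →L[ℂ] FeatureSpace} (hA : IsUnit (gram A))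
    (w : ParamSpace M) : gram A (Ring.inverse (gram A) w) = w := by
  have h := Ring.mul_inverse_cancel _ hA
  exact DFunLike.congr_fun h w

/-- `A (A† A)⁻¹ A†` is the orthogonal projection onto the range of `A`. -/
theorem apply_inverse_gram_adjoint {A : ParamSpace M →L[ℂ] FeatureSpace} (hA : IsUnit (gram A))
    (h : FeatureSpace) :
    A (Ring.inverse (gram A) (ContinuousLinearMap.adjoint A h)) = A.range.starProjection h := by
  symm
  refine Submodule.eq_starProjection_of_mem_of_inner_eq_zero ⟨_, rfl⟩ ?_
  rintro _ ⟨u, rfl⟩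
  have h1 := apply_gram_inverse hA (ContinuousLinearMap.adjoint A h)
  rw [gram, ContinuousLinearMap.comp_apply] at h1
  change inner ℂ _ (A u) = 0
  rw [← ContinuousLinearMap.adjoint_inner_left, map_sub, gram, h1, sub_self, inner_zero_left]

/-- The preconditioner cancels `A†A` in the norm term and the prefactor cancels `s |α_s|`, leaving a
pull along a fixed vector and a radial decay. -/
theorem flowField_eq {N : ℕ} (σ : Activation) (a : Fin M → Circle) {α : ℕ → ℂ} {s : ℕ}
    {hstar : FeatureSpace} (hs1 : 1 ≤ s) (hsN : s ≤ Nat.sqrt N) (hαs : α s ≠ 0)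
    (hsupp : ∀ k : ℕ+, Nat.sqrt N < (k : ℕ) → hstar k = 0)
    (hA : IsUnit (gram (featureMatrix σ a))) (w : ParamSpace M) :
    flowField N σ a α s hstar w =
      conj (correlation (featureMatrix σ a) hstar w) ^ (s - 1) •
        Ring.inverse (gram (featureMatrix σ a))
          (ContinuousLinearMap.adjoint (featureMatrix σ a) hstar) -
      ((‖featureMatrix σ a w‖ ^ 2) ^ (s - 1) : ℝ) • w := by
  obtain ⟨D, hD, hDu⟩ := hasFDerivAt_loss_formula (featureMatrix σ a) hstar ‖α s‖ s w
  have hloss : loss N σ a α s hstar = _ := funext (loss_eq σ a hs1 hsN hαs hsupp)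
  have hc : (s : ℝ) * ‖α s‖ ≠ 0 :=
    mul_ne_zero (by exact_mod_cast Nat.one_le_iff_ne_zero.1 hs1) (norm_ne_zero_iff.2 hαs)
  rw [flowField, hloss, complexGradient_eq_of_hasFDerivAt hD hDu,
    ContinuousLinearMap.map_smul_of_tower,
    map_sub, ContinuousLinearMap.map_smul_of_tower, map_smul, gram_inverse_apply hA, smul_smul]
  have : -(1 / ((s : ℝ) * ‖α s‖)) * (‖α s‖ * s) = -1 := by
    rw [mul_comm ‖α s‖]
    field_simp
  rw [this, neg_one_smul, neg_sub]

theorem orthogonalMass_eq (A : ParamSpace M →L[ℂ] FeatureSpace) {hstar : FeatureSpace}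
    (hnorm : ‖hstar‖ = 1) (w : ParamSpace M) :
    orthogonalMass A hstar w = ‖A w‖ ^ 2 - ‖correlation A hstar w‖ ^ 2 := by
  have h := Submodule.norm_sq_eq_add_norm_sq_starProjection (A w) (Submodule.span ℂ {hstar})
  rw [Submodule.starProjection_unit_singleton ℂ hnorm, norm_smul, hnorm, mul_one] at h
  rw [orthogonalMass, correlation, h]
  ring

theorem inner_starProjection_eq (A : ParamSpace M →L[ℂ] FeatureSpace) (hstar : FeatureSpace) :
    inner ℂ hstar (A.range.starProjection hstar) = ((1 - approxError A hstar : ℝ) : ℂ) := by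
  have h := Submodule.starProjection_inner_eq_zero (K := A.range) hstar
    (A.range.starProjection hstar) (Submodule.starProjection_apply_mem _ _)
  rw [inner_sub_left, sub_eq_zero] at h
  rw [h, inner_self_eq_norm_sq_to_K, approxError]
  simp

theorem inner_apply_starProjection (A : ParamSpace M →L[ℂ] FeatureSpace) (hstar : FeatureSpace)
    (w : ParamSpace M) :
    inner ℂ (A w) (A.range.starProjection hstar) = conj (correlation A hstar w) := by
  have h := Submodule.starProjection_inner_eq_zero (K := A.range) hstar (A w) ⟨w, rfl⟩
  rw [inner_sub_left, sub_eq_zero] at h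
  rw [correlation, h, inner_conj_symm]

end Gradient

/-! ### Polar form of the equation for `m`. -/

section SummaryStatistics

variable {J : Set ℝ} {m : ℝ → ℂ} {r θ : ℝ → ℝ} {t : ℝ} {s : ℕ}

theorem ofReal_mul_cexp_pow_re (r θ : ℝ) (s : ℕ) :
    (((r : ℂ) * Complex.exp (Complex.I * (θ : ℂ))) ^ s).re = r ^ s * Real.cos (s * θ) := by
  have h : ((r : ℂ) * Complex.exp (Complex.I * (θ : ℂ))) ^ s =
      ((r ^ s : ℝ) : ℂ) * Complex.exp (((s * θ : ℝ) : ℂ) * Complex.I) := by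
    rw [mul_pow, ← Complex.exp_nat_mul]
    push_cast
    ring_nf
  rw [h, Complex.re_ofReal_mul, Complex.exp_ofReal_mul_I_re]

theorem norm_ofReal_mul_cexp {r : ℝ} (hr : 0 ≤ r) (θ : ℝ) :
    ‖(r : ℂ) * Complex.exp (Complex.I * (θ : ℂ))‖ = r := by
  rw [mul_comm Complex.I, norm_mul, Complex.norm_exp_ofReal_mul_I, mul_one, Complex.norm_real,
    Real.norm_of_nonneg hr]

/-- With `z = m` and the bracket equal to `m'`, this is half the derivative of `|m|²`; the next
lemma is likewise the derivative of `Re m^s` divided by `s`. -/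
theorem conj_mul_field_re {z : ℂ} {E S : ℝ} (hs : 1 ≤ s) :
    (conj z * (E * conj z ^ (s - 1) - S * z)).re = E * (z ^ s).re - S * ‖z‖ ^ 2 := by
  obtain ⟨p, rfl⟩ := Nat.exists_eq_add_of_le' hs
  have h : conj z * (E * conj z ^ (p + 1 - 1) - S * z) =
      (E : ℂ) * conj (z ^ (p + 1)) - ((S * ‖z‖ ^ 2 : ℝ) : ℂ) := by
    rw [map_pow, Nat.add_sub_cancel, pow_succ']
    push_cast
    rw [← Complex.conj_mul']
    ring
  rw [h, Complex.sub_re, Complex.re_ofReal_mul, Complex.conj_re, Complex.ofReal_re]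

theorem pow_mul_field_re {z : ℂ} {E S : ℝ} (hs : 1 ≤ s) :
    (z ^ (s - 1) * (E * conj z ^ (s - 1) - S * z)).re =
      E * (‖z‖ ^ 2) ^ (s - 1) - S * (z ^ s).re := by
  obtain ⟨p, rfl⟩ := Nat.exists_eq_add_of_le' hs
  have h : z ^ (p + 1 - 1) * (E * conj z ^ (p + 1 - 1) - S * z) =
      ((E * (‖z‖ ^ 2) ^ p : ℝ) : ℂ) - (S : ℂ) * z ^ (p + 1) := by
    rw [Nat.add_sub_cancel, pow_succ z]
    push_cast
    rw [← Complex.conj_mul']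
    ring
  rw [h, Complex.sub_re, Complex.re_ofReal_mul, Complex.ofReal_re, Nat.add_sub_cancel]

theorem hasDerivWithinAt_radius_sq
    (hm : ∀ τ ∈ J, 0 ≤ r τ ∧ m τ = (r τ : ℂ) * Complex.exp (Complex.I * (θ τ : ℂ)))
    (hs : 1 ≤ s) {E S : ℝ} (ht : t ∈ J)
    (hd : HasDerivWithinAt m (E * conj (m t) ^ (s - 1) - S * m t) J t) :
    HasDerivWithinAt (fun τ => r τ ^ 2)
      (2 * (E * (r t ^ s * Real.cos (s * θ t)) - S * r t ^ 2)) J t := by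
  have hr : ∀ τ ∈ J, ‖m τ‖ = r τ := fun τ hτ => by
    rw [(hm τ hτ).2, norm_ofReal_mul_cexp (hm τ hτ).1]
  have h := hd.norm_sq
  rw [Complex.inner, mul_comm _ (conj (m t)), conj_mul_field_re hs, hr t ht, (hm t ht).2,
    ofReal_mul_cexp_pow_re] at h
  exact h.congr (fun τ hτ => by rw [hr τ hτ]) (by rw [hr t ht])

theorem hasDerivWithinAt_radius_of_ne_zero
    (hm : ∀ τ ∈ J, 0 ≤ r τ ∧ m τ = (r τ : ℂ) * Complex.exp (Complex.I * (θ τ : ℂ)))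
    (hs : 1 ≤ s) {E S : ℝ} (ht : t ∈ J)
    (hd : HasDerivWithinAt m (E * conj (m t) ^ (s - 1) - S * m t) J t) (hr : r t ≠ 0) :
    HasDerivWithinAt r (E * r t ^ (s - 1) * Real.cos (s * θ t) - S * r t) J t := by
  have h := (hasDerivWithinAt_radius_sq hm hs ht hd).sqrt (pow_ne_zero 2 hr)
  have h2 := h.congr (fun τ hτ => (Real.sqrt_sq (hm τ hτ).1).symm) (Real.sqrt_sq (hm t ht).1).symm
  refine h2.congr_deriv ?_
  rw [Real.sqrt_sq (hm t ht).1]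
  obtain ⟨p, rfl⟩ := Nat.exists_eq_add_of_le' hs
  rw [Nat.add_sub_cancel]
  field_simp
  ring

/-- The square root is unavailable at `0`. For `s ≥ 2` the field vanishes at `m = 0`, so `r = |m|`
is `o(τ - t)`; for `s = 1` it need not vanish, and `|m|` can have a corner. -/
theorem hasDerivWithinAt_radius_of_eq_zero
    (hm : ∀ τ ∈ J, 0 ≤ r τ ∧ m τ = (r τ : ℂ) * Complex.exp (Complex.I * (θ τ : ℂ)))
    (hs : 2 ≤ s) {E S : ℝ} (ht : t ∈ J)
    (hd : HasDerivWithinAt m (E * conj (m t) ^ (s - 1) - S * m t) J t) (hr : r t = 0) :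
    HasDerivWithinAt r (E * r t ^ (s - 1) * Real.cos (s * θ t) - S * r t) J t := by
  have hmt : m t = 0 := by rw [(hm t ht).2, hr]; simp
  have hs0 : s - 1 ≠ 0 := by omega
  have hnorm : ∀ τ ∈ J, ‖m τ‖ = ‖r τ‖ := fun τ hτ => by
    rw [(hm τ hτ).2, norm_ofReal_mul_cexp (hm τ hτ).1, Real.norm_of_nonneg (hm τ hτ).1]
  rw [hmt, map_zero, zero_pow hs0, mul_zero, mul_zero, sub_zero] at hd
  rw [hr, zero_pow hs0, mul_zero, zero_mul, mul_zero, sub_zero]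
  rw [hasDerivWithinAt_iff_isLittleO] at hd ⊢
  refine (Asymptotics.isLittleO_norm_left.1 ?_)
  refine (Asymptotics.isLittleO_norm_left.2 hd).congr' ?_ Filter.EventuallyEq.rfl
  filter_upwards [self_mem_nhdsWithin] with τ hτ
  simp [hmt, hr, hnorm τ hτ]

theorem hasDerivWithinAt_cos_phase
    (hm : ∀ τ ∈ J, 0 ≤ r τ ∧ m τ = (r τ : ℂ) * Complex.exp (Complex.I * (θ τ : ℂ)))
    (hs : 1 ≤ s) {E S : ℝ} (ht : t ∈ J)
    (hd : HasDerivWithinAt m (E * conj (m t) ^ (s - 1) - S * m t) J t) (hr : r t ≠ 0) :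
    HasDerivWithinAt (fun τ => Real.cos (s * θ τ))
      (E * s * r t ^ ((s : ℤ) - 2) * (1 - Real.cos (s * θ t) ^ 2)) J t := by
  have hdr := hasDerivWithinAt_radius_of_ne_zero hm hs ht hd hr
  have hre := Complex.reCLM.hasFDerivAt.comp_hasDerivWithinAt t (hd.fun_pow s)
  have hq := hre.fun_div (hdr.fun_pow s) (pow_ne_zero s hr)
  -- No regularity of `θ` is assumed: near `t` the cosine equals `Re m^s / r^s`, which is
  -- differentiable.
  have hev : (fun τ => Real.cos (s * θ τ)) =ᶠ[nhdsWithin t J]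
      fun τ => (Complex.reCLM ∘ fun τ => m τ ^ s) τ / r τ ^ s := by
    filter_upwards [self_mem_nhdsWithin, hdr.continuousWithinAt.eventually_ne hr] with τ hτ hrτ
    simp only [Function.comp_apply, Complex.reCLM_apply]
    rw [(hm τ hτ).2, ofReal_mul_cexp_pow_re, mul_div_cancel_left₀ _ (pow_ne_zero s hrτ)]
  have h2 := hq.congr_of_eventuallyEq hev (hev.self_of_nhdsWithin ht)
  refine h2.congr_deriv ?_
  have hrt : ‖m t‖ = r t := by rw [(hm t ht).2, norm_ofReal_mul_cexp (hm t ht).1]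
  have hmre : (m t ^ s).re = r t ^ s * Real.cos (s * θ t) := by
    rw [(hm t ht).2, ofReal_mul_cexp_pow_re]
  simp only [Function.comp_apply, Complex.reCLM_apply]
  rw [mul_assoc (s : ℂ), ← Complex.ofReal_natCast, Complex.re_ofReal_mul, pow_mul_field_re hs,
    hmre, hrt]
  obtain ⟨p, rfl⟩ := Nat.exists_eq_add_of_le' hs
  -- The integer exponent `s - 2` is `-1` when `s = 1`.
  have hz : r t ^ (((p + 1 : ℕ) : ℤ) - 2) = r t ^ p / r t := by
    rw [eq_div_iff hr, ← zpow_add_one₀ hr, ← zpow_natCast]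
    congr 1
    push_cast
    ring
  rw [hz, Nat.add_sub_cancel]
  field_simp
  ring

end SummaryStatistics

end DeepSets

end

/-! ### The closed system along the flow. -/

theorem theorem4p1 {N M : ℕ} (σ : DeepSets.Activation) (a : Fin M → Circle)
    (α : ℕ → ℂ) (hα : ∀ j, α j ≠ 0 → 1 ≤ j ∧ j ≤ Nat.sqrt N)
    (s : ℕ) (hs : DeepSets.IsInformationExponent α s)
    (hstar : DeepSets.FeatureSpace) (hnorm : ‖hstar‖ = 1)
    (hsupp : ∀ k : ℕ+, Nat.sqrt N < (k : ℕ) → hstar k = 0)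
    (hA : IsUnit (DeepSets.gram (DeepSets.featureMatrix σ a))) :
    -- the loss is well defined and differentiable in the real and imaginary parts of `w`
    (∀ w : DeepSets.ParamSpace M, Integrable
      (fun x => -(DeepSets.teacher α hstar x *
        (starRingEnd ℂ) (DeepSets.student σ a α s w x)).re) (DeepSets.vandermondeLaw N)) ∧
    Differentiable ℝ (DeepSets.loss N σ a α s hstar) ∧
    -- along every solution of the flow, with `m = r e^{iθ}`
    ∀ (J : Set ℝ) (w : ℝ → DeepSets.ParamSpace M),
      (∀ t ∈ J, HasDerivWithinAt w (DeepSets.flowField N σ a α s hstar (w t)) J t) →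
      ∀ (r θ v : ℝ → ℝ) (δ : ℝ),
        (∀ t ∈ J, 0 ≤ r t ∧
          DeepSets.correlation (DeepSets.featureMatrix σ a) hstar (w t) =
            (r t : ℂ) * Complex.exp (Complex.I * (θ t : ℂ))) →
        (∀ t ∈ J, v t = DeepSets.orthogonalMass (DeepSets.featureMatrix σ a) hstar (w t)) →
        δ = DeepSets.approxError (DeepSets.featureMatrix σ a) hstar →
        ∀ t ∈ J,
          (r t ≠ 0 ∨ 2 ≤ s → HasDerivWithinAt r
            ((1 - δ) * r t ^ (s - 1) * Real.cos (s * θ t)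
              - (v t + r t ^ 2) ^ (s - 1) * r t) J t) ∧
          (r t ≠ 0 → HasDerivWithinAt (fun τ => Real.cos (s * θ τ))
            ((1 - δ) * s * r t ^ ((s : ℤ) - 2) * (1 - Real.cos (s * θ t) ^ 2)) J t) ∧
          HasDerivWithinAt v
            (2 * δ * r t ^ s * Real.cos (s * θ t)
              - 2 * (v t + r t ^ 2) ^ (s - 1) * v t) J t := by
  have hαs : α s ≠ 0 := hs.1.2
  have hs1 : 1 ≤ s := hs.1.1
  have hsN : s ≤ Nat.sqrt N := (hα s hαs).2
  refine ⟨fun w => (DeepSets.integrable_teacher_mul_conj_student σ a hsupp w).re.neg, ?_, ?_⟩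
  · rw [funext (DeepSets.loss_eq σ a hs1 hsN hαs hsupp)]
    intro w
    obtain ⟨D, hD, -⟩ := DeepSets.hasFDerivAt_loss_formula (DeepSets.featureMatrix σ a) hstar
      ‖α s‖ s w
    exact hD.differentiableAt
  intro J w hw r θ v δ hm hv hδ t ht
  set A := DeepSets.featureMatrix σ a with hAdef
  have hwt := hw t ht
  rw [DeepSets.flowField_eq σ a hs1 hsN hαs hsupp hA, ← hAdef] at hwt
  have hr : ∀ τ ∈ J, ‖DeepSets.correlation A hstar (w τ)‖ = r τ := fun τ hτ => by
    rw [(hm τ hτ).2, DeepSets.norm_ofReal_mul_cexp (hm τ hτ).1]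
  have hn : ∀ τ ∈ J, ‖A (w τ)‖ ^ 2 = v τ + r τ ^ 2 := fun τ hτ => by
    rw [hv τ hτ, DeepSets.orthogonalMass_eq A hnorm, hr τ hτ, sub_add_cancel]
  rw [hn t ht] at hwt
  set S := (v t + r t ^ 2) ^ (s - 1) with hS
  -- Pairing `A ẇ` with `h*` turns the pull into `⟨h*, P_A h*⟩ = 1 - δ`.
  have hmd : HasDerivWithinAt (fun τ => DeepSets.correlation A hstar (w τ))
      (((1 - δ : ℝ) : ℂ) * (starRingEnd ℂ) (DeepSets.correlation A hstar (w t)) ^ (s - 1) -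
        (S : ℂ) * DeepSets.correlation A hstar (w t)) J t := by
    have h := (DeepSets.hasFDerivAt_correlation A hstar (w t)).comp_hasDerivWithinAt t hwt
    refine h.congr_deriv ?_
    simp only [ContinuousLinearMap.coe_restrictScalars', ContinuousLinearMap.comp_apply,
      innerSL_apply_apply]
    rw [← Complex.coe_smul, map_sub, map_smul, map_smul, DeepSets.apply_inverse_gram_adjoint hA,
      inner_sub_right, inner_smul_right, inner_smul_right, DeepSets.inner_starProjection_eq, hδ,
      mul_comm, DeepSets.correlation]
  have hnd : HasDerivWithinAt (fun τ => v τ + r τ ^ 2)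
      (2 * (r t ^ s * Real.cos (s * θ t) - S * (v t + r t ^ 2))) J t := by
    obtain ⟨D, hD, hDu⟩ := DeepSets.hasFDerivAt_norm_sq_comp A (w t)
    have h := hD.comp_hasDerivWithinAt t hwt
    refine (h.congr_deriv ?_).congr (fun τ hτ => (hn τ hτ).symm) (hn t ht).symm
    rw [hDu, ← Complex.coe_smul, map_sub, map_smul, map_smul,
      DeepSets.apply_inverse_gram_adjoint hA, inner_sub_right, inner_smul_right, inner_smul_right,
      DeepSets.inner_apply_starProjection, ← pow_succ, Nat.sub_add_cancel hs1, ← map_pow,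
      Complex.sub_re, Complex.conj_re, (hm t ht).2, DeepSets.ofReal_mul_cexp_pow_re,
      Complex.re_ofReal_mul, ← hn t ht]
    congr 3
    exact inner_self_eq_norm_sq (𝕜 := ℂ) _
  refine ⟨fun h => ?_, fun h => DeepSets.hasDerivWithinAt_cos_phase hm hs1 ht hmd h, ?_⟩
  · by_cases hr0 : r t = 0
    · exact DeepSets.hasDerivWithinAt_radius_of_eq_zero hm (h.resolve_left fun h => h hr0) ht hmd
        hr0
    · exact DeepSets.hasDerivWithinAt_radius_of_ne_zero hm hs1 ht hmd hr0
  -- Writing `v` as `(v + r²) - r²` uses only `r²`, which is differentiable even where `r = 0`;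
  -- hence no condition on `r`.
  · have h := hnd.fun_sub (DeepSets.hasDerivWithinAt_radius_sq hm hs1 ht hmd)
    simp only [add_sub_cancel_right] at h
    refine h.congr_deriv ?_
    ring
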